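/- Let $(K,\oplus,\otimes,\mathbb 0,\mathbb 1)$ be a commutative semiring that is idempotent, i.e. $a\oplus a=a$ for all $a\in K$. For a commutative semiring $R$, the Kleene star of a series $T\in R[[X]]$ with zero constant coefficient is $T^*=\mathbb 1\oplus T\oplus T^2\oplus\cdots$. For $N\ge 0$, $c\in R^{1\times N}$, $A\in R^{N\times N}$ and $b\in R^{N\times 1}$ put $$c(AX)^*b=\bigoplus_{k\ge 0} (cA^kb)\,X^k\in R[[X]].$$ A star-height-one representation of a series $T\in R[[X]]$ is an equality $$T=P\oplus X^{\kappa c}\Big(\bigoplus_{1\le i\le \rho}u_iX^{\mu_i}(q_iX^{c})^*\Big),$$ where $c\geq 1$ and $\kappa,\rho\ge 0$ are integers, $P\in R[X]$ has degree less than $\kappa c$, $u_i,q_i\in R$ and $0\le\mu_i\le c-1$. When $R=K[\Sigma]$ is a polynomial semiring, write $|p|$ for the number of monomials appearing in $p\in K[\Sigma]$, and let the maximal monomial count of the representation be $$m=\max\Big(\max_{0\le i<\kappa c}|\langle P,X^i\rangle|,\ \max_{1\le i\le\rho}\max(|u_i|,|q_i|)\Big),$$ where $\langle P,X^i\rangle$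 is the coefficient of $X^i$ in $P$, and where the maximum of the empty set is $0$. Let $\Sigma_N$ be the set of $2N+N^2$ commuting indeterminates $\mathsf c_i,\mathsf A_{ij},\mathsf b_j$ ($1\le i,j\le N$), and let $\mathsf S_N=\mathsf c(\mathsf AX)^*\mathsf b\in K[\Sigma_N][[X]]$ be the universal series of dimension $N$, where $\mathsf c=(\mathsf c_i)$, $\mathsf A=(\mathsf A_{ij})$, $\mathsf b=(\mathsf b_j)$. Then there is a constant $B$, independent of $N$ and $K$, such that for every $N$: 1. $\mathsf S_N$ has a star-height-one representation over $K[\Sigma_N]$ with $c=N!$, $\kappa\le B\,N!$, $\rho\le 2^{B\,N!}$ and $m\le 2^{B\,N!}$. That is, $c_1=N!$, $\kappa_1=O(N!)$, $\rho=2^{O(N!)}$ and $m(\mathsf S_N)=2^{O(N!)}$. 2. More generally, for every set $\Sigma$ of commuting indeterminates and all $c\in K[\Sigma]^{1\times N}$, $A\in K[\Sigma]^{N\times N}$, $b\in K[\Sigma]^{N\times 1}$, the series $c(AX)^*b$ has a star-height-one representation over $K[\Sigma]$ whose period is $N!$, with $\kappa\le B\,N!$ and $\rho\le 2^{B\,N!}$.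 -/

import Mathlib

namespace MaxPlus

open PowerSeries in
/-- Kleene's star `S* = S⁰ ⊕ S ⊕ S² ⊕ ⋯` of a series `S` with zero constant coefficient.  For such
an `S` the coefficient of `X ^ n` in `S ^ k` vanishes when `k > n`, so the sum is finite
coefficientwise. (The value is meaningful only when the constant coefficient is zero.) -/
noncomputable def kleeneStar {R : Type*} [CommSemiring R] (S : PowerSeries R) : PowerSeries R :=
  PowerSeries.mk fun n => ∑ k ∈ Finset.range (n + 1), coeff n (S ^ k)

open PowerSeries in
/-- Kleene's star `M* = I ⊕ M ⊕ M² ⊕ ⋯` of a square matrix of series, all of whose entries have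
zero constant coefficient. -/
noncomputable def matrixStar {R : Type*} [CommSemiring R] {N : ℕ}
    (M : Matrix (Fin N) (Fin N) (PowerSeries R)) : Matrix (Fin N) (Fin N) (PowerSeries R) :=
  Matrix.of fun i j => PowerSeries.mk fun n => ∑ k ∈ Finset.range (n + 1), coeff n ((M ^ k) i j)

/-- The series `c (A X)* b` attached to a row vector `c`, a square matrix `A` and a column
vector `b` with entries in `R`. -/
noncomputable def realizationSeries {R : Type*} [CommSemiring R] {N : ℕ}
    (c : Fin N → R) (A : Matrix (Fin N) (Fin N) R) (b : Fin N → R) : PowerSeries R :=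
  (fun i => PowerSeries.C (c i)) ⬝ᵥ
    (matrixStar (A.map fun a => PowerSeries.C a * PowerSeries.X)).mulVec
      (fun j => PowerSeries.C (b j))

/-- `c (A X)* b = c b ⊕ c A b X ⊕ c A² b X² ⊕ ⋯`. -/
theorem coeff_realizationSeries {R : Type*} [CommSemiring R] {N : ℕ}
    (c : Fin N → R) (A : Matrix (Fin N) (Fin N) R) (b : Fin N → R) (k : ℕ) :
    PowerSeries.coeff k (realizationSeries c A b) = c ⬝ᵥ (A ^ k).mulVec b := by
  have key : ∀ (l : ℕ) (i j : Fin N),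
      ((A.map fun a => PowerSeries.C a * PowerSeries.X) ^ l) i j
        = PowerSeries.C ((A ^ l) i j) * PowerSeries.X ^ l := by
    intro l
    induction l with
    | zero => intro i j; by_cases h : i = j <;> simp [h]
    | succ l ih =>
      intro i j
      rw [pow_succ, Matrix.mul_apply, pow_succ A, Matrix.mul_apply, map_sum, Finset.sum_mul]
      refine Finset.sum_congr rfl fun x _ => ?_
      rw [ih, Matrix.map_apply, map_mul, pow_succ]
      ring
  have star : ∀ i j, PowerSeries.coeff k
      (matrixStar (A.map fun a => PowerSeries.C a * PowerSeries.X) i j) = (A ^ k) i j := by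
    intro i j
    simp only [matrixStar, Matrix.of_apply, PowerSeries.coeff_mk, key, PowerSeries.coeff_C_mul,
      PowerSeries.coeff_X_pow]
    simp
  simp only [realizationSeries, dotProduct, Matrix.mulVec, map_sum, PowerSeries.coeff_C_mul,
    PowerSeries.coeff_mul_C, star]

/-- The `2N + N²` commuting indeterminates `cᵢ`, `Aᵢⱼ`, `bⱼ`. -/
inductive RealizationVar (N : ℕ) : Type
  | c (i : Fin N) : RealizationVar N
  | A (i j : Fin N) : RealizationVar N
  | b (j : Fin N) : RealizationVar N

/-- The universal series `c (A X)* b` of dimension `N`, where the entries of `c`, `A`, `b` are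
distinct indeterminates. -/
noncomputable def universalSeries (K : Type*) [CommSemiring K] (N : ℕ) :
    PowerSeries (MvPolynomial (RealizationVar N) K) :=
  realizationSeries (fun i => MvPolynomial.X (RealizationVar.c i))
    (Matrix.of fun i j => MvPolynomial.X (RealizationVar.A i j))
    (fun j => MvPolynomial.X (RealizationVar.b j))

/-- The data of a star-height-one expression
`P ⊕ X ^ (κ c) (⊕_{1 ≤ i ≤ ρ} uᵢ X ^ μᵢ (qᵢ X ^ c)*)`
with `deg P < κ c` (the zero polynomial has degree `⊥`) and `0 ≤ μᵢ ≤ c - 1`. -/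
structure StarHeightOneExpr (R : Type*) [CommSemiring R] where
  /-- the period -/
  c : ℕ
  c_pos : 0 < c
  /-- the length of the transient part, in periods -/
  κ : ℕ
  /-- the number of terms of the periodic part -/
  ρ : ℕ
  /-- the transient part -/
  P : Polynomial R
  degree_P_lt : P.degree < ((κ * c : ℕ) : WithBot ℕ)
  u : Fin ρ → R
  q : Fin ρ → R
  μ : Fin ρ → ℕ
  μ_lt : ∀ i, μ i < c

/-- The series denoted by a star-height-one expression. -/
noncomputable def StarHeightOneExpr.series {R : Type*} [CommSemiring R]
    (E : StarHeightOneExpr R) : PowerSeries R :=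
  (E.P : PowerSeries R) + PowerSeries.X ^ (E.κ * E.c) *
    ∑ i, PowerSeries.C (E.u i) * PowerSeries.X ^ E.μ i *
      kleeneStar (PowerSeries.C (E.q i) * PowerSeries.X ^ E.c)

/-- The maximal monomial count of a star-height-one expression over `K[σ]`: the maximum of the
numbers of monomials of `⟨P, X ^ i⟩` for `0 ≤ i < κ c`, and of `uᵢ`, `qᵢ` for `1 ≤ i ≤ ρ`. -/
noncomputable def StarHeightOneExpr.maxMonomials {σ K : Type*} [CommSemiring K]
    (E : StarHeightOneExpr (MvPolynomial σ K)) : ℕ :=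
  max ((Finset.range (E.κ * E.c)).sup fun i => (E.P.coeff i).support.card)
    (Finset.univ.sup fun i : Fin E.ρ => max (E.u i).support.card (E.q i).support.card)

end MaxPlus

/-! The coefficient of `X ^ n` is the sum of the weights of all walks of length `n` on `N` vertices.
Group the walks by their set `Z` of visited vertices. Within one group a simple cycle inside `Z` can
be inserted into any walk, and since weights commute only the multiset of inserted cycles matters.

Every walk is, up to rearrangement, a walk of length `O(N²)` with the same visited set together with
simple cycles (`exists_decomposition`). There are at most `3 N!` simple cycles, so in a walk of
length at least about `3 (N!)²` the pigeonhole principle gives one simple cycle `γ` occurring at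
least `N! / |γ|` times. Removing that many copies shortens the walk by exactly `N!`. Conversely they
can always be reinserted. By idempotency only the set of terms of a sum matters, so for large `n`
the sum for `Z` at `n + N!` is `loopSum A Z` times the sum at `n` (`walkSum_add_factorial`).

Each of the `2 ^ N` groups is thus eventually geometric along each of the `N!` residue classes, with
one ratio per group. The monomial counts follow from degree bounds alone. -/

namespace MaxPlus

/-! ### Walks, and removal and insertion of simple cycles -/

section Walks

variable {V R : Type*} [CommSemiring R]

/-- The last vertex of the walk that starts at `x` and then visits the vertices of `l`. -/
def walkEnd (x : V) (l : List V) : V := l.foldl (fun _ y => y) x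

/-- The product of the entries of `A` along the walk that starts at `x` and then visits `l`. -/
def walkWeight (A : Matrix V V R) : V → List V → R
  | _, [] => 1
  | x, y :: l => A x y * walkWeight A y l

/-- The product of the entries of `A` along the closed walk through the vertices of a list. -/
def cycleWeight (A : Matrix V V R) : List V → R
  | [] => 1
  | v :: g => walkWeight A v (g ++ [v])

/-- The set of vertices visited by the walk that starts at `x` and then visits `l`. -/
def visited [DecidableEq V] (x : V) (l : List V) : Finset V := (x :: l).toFinset

theorem walkEnd_append (x : V) (p q : List V) :
    walkEnd x (p ++ q) = walkEnd (walkEnd x p) q := by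
  simp [walkEnd]

@[simp] theorem walkEnd_concat (x v : V) (p : List V) : walkEnd x (p ++ [v]) = v := by
  simp [walkEnd]

theorem walkWeight_append (A : Matrix V V R) (x : V) (p q : List V) :
    walkWeight A x (p ++ q) = walkWeight A x p * walkWeight A (walkEnd x p) q := by
  induction p generalizing x with
  | nil => simp [walkWeight, walkEnd]
  | cons y p ih => simp only [List.cons_append, walkWeight, ih, mul_assoc]; rfl

variable [DecidableEq V]

theorem mem_visited {x y : V} {l : List V} : y ∈ visited x l ↔ y = x ∨ y ∈ l := by
  simp [visited]

theorem exists_append_of_mem_visited {x v : V} {l : List V} (h : v ∈ visited x l) :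
    ∃ p q, l = p ++ q ∧ walkEnd x p = v := by
  rcases mem_visited.1 h with rfl | h
  · exact ⟨[], l, rfl, rfl⟩
  · obtain ⟨p, q, rfl⟩ := List.append_of_mem h
    exact ⟨p ++ [v], q, by simp, by simp⟩

/-- A closed walk through visited vertices can be inserted into a walk. -/
theorem exists_insert_cycle (A : Matrix V V R) (x : V) (l γ : List V)
    (hγ : ∀ y ∈ γ, y ∈ visited x l) :
    ∃ l', visited x l' = visited x l ∧ walkEnd x l' = walkEnd x l ∧
      l'.length = l.length + γ.length ∧
      walkWeight A x l' = walkWeight A x l * cycleWeight A γ := by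
  cases γ with
  | nil => exact ⟨l, rfl, rfl, rfl, by simp [cycleWeight]⟩
  | cons v g =>
    obtain ⟨p, q, rfl, hp⟩ := exists_append_of_mem_visited (hγ v (by simp))
    refine ⟨p ++ ((g ++ [v]) ++ q), ?_, ?_, ?_, ?_⟩
    · ext y
      have := hγ y
      simp only [mem_visited, List.mem_append, List.mem_cons] at this ⊢
      grind
    · simp only [walkEnd_append _ p, walkEnd_append _ (g ++ [v]), walkEnd_concat, hp]
    · simp; omega
    · simp only [walkWeight_append _ _ p, walkWeight_append _ _ (g ++ [v]), walkEnd_concat, hp,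
        cycleWeight]
      ring

theorem exists_insert_cycles (A : Matrix V V R) (x : V) (l : List V) (m : Multiset (List V))
    (hm : ∀ γ ∈ m, ∀ y ∈ γ, y ∈ visited x l) :
    ∃ l', visited x l' = visited x l ∧ walkEnd x l' = walkEnd x l ∧
      l'.length = l.length + (m.map List.length).sum ∧
      walkWeight A x l' = walkWeight A x l * (m.map (cycleWeight A)).prod := by
  induction m using Multiset.induction with
  | empty => exact ⟨l, rfl, rfl, by simp, by simp⟩
  | cons γ m ih =>
    obtain ⟨l₁, hv, he, hl, hw⟩ := ih fun δ hδ => hm δ (Multiset.mem_cons_of_mem hδ)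
    obtain ⟨l₂, hv', he', hl', hw'⟩ := exists_insert_cycle A x l₁ γ
      (hv ▸ hm γ (Multiset.mem_cons_self γ m))
    refine ⟨l₂, hv'.trans hv, he'.trans he, ?_, ?_⟩
    · rw [hl', hl, Multiset.map_cons, Multiset.sum_cons]; ring
    · rw [hw', hw, Multiset.map_cons, Multiset.prod_cons]; ring

/-- A walk splits into a short walk through the same vertices and simple cycles. The short walk
consists of a part `a` that reaches all vertices and a part `t` without repetitions. -/
theorem exists_decomposition_aux [Fintype V] (A : Matrix V V R) (x : V) (l : List V) :
    ∃ (a t : List V) (m : Multiset (List V)),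
      a.length ≤ (Fintype.card V + 1) * (visited x l).card ∧ t.Nodup ∧
      visited x a = visited x l ∧ (∀ y ∈ t, y ∈ visited x l) ∧
      walkEnd x (a ++ t) = walkEnd x l ∧
      l.length = (a ++ t).length + (m.map List.length).sum ∧
      walkWeight A x l = walkWeight A x (a ++ t) * (m.map (cycleWeight A)).prod ∧
      ∀ γ ∈ m, γ ≠ [] ∧ γ.Nodup ∧ ∀ y ∈ γ, y ∈ visited x l := by
  induction l using List.reverseRecOn with
  | nil => exact ⟨[], [], 0, by simp, by simp, rfl, by simp, rfl, by simp, by simp, by simp⟩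
  | append_singleton l v ih =>
    obtain ⟨a, t, m, ha, ht, hva, hvt, he, hl, hw, hm⟩ := ih
    have hvis : visited x (l ++ [v]) = insert v (visited x l) := by
      ext y; simp only [mem_visited, List.mem_append, List.mem_singleton, Finset.mem_insert]; tauto
    have hwv : walkWeight A x (l ++ [v]) =
        walkWeight A x (a ++ t ++ [v]) * (m.map (cycleWeight A)).prod := by
      rw [walkWeight_append _ _ l, walkWeight_append _ _ (a ++ t), hw, he]; ring
    -- Only `t` is ever cut, and `a` alone already reaches every vertex, so extracting a cycle loses
    -- no visited vertex.
    by_cases hv : v ∈ visited x l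
    · have hvis' : visited x (l ++ [v]) = visited x l := by rw [hvis, Finset.insert_eq_of_mem hv]
      rw [hvis']
      by_cases hvt' : v ∈ t
      · obtain ⟨t₁, t₂, rfl⟩ := List.append_of_mem hvt'
        have hnd : (t₁ ++ [v]).Nodup ∧ (v :: t₂).Nodup := by
          grind
        refine ⟨a, t₁ ++ [v], (v :: t₂) ::ₘ m, ha, hnd.1, hva, ?_, ?_, ?_, ?_, ?_⟩
        · intro y hy; apply hvt; simp only [List.mem_append, List.mem_cons] at hy ⊢; grind
        · simp [← List.append_assoc]
        · simp at hl ⊢; omega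
        · rw [hwv, Multiset.map_cons, Multiset.prod_cons, cycleWeight,
            show a ++ (t₁ ++ v :: t₂) ++ [v] = (a ++ (t₁ ++ [v])) ++ (t₂ ++ [v]) by simp,
            walkWeight_append _ _ (a ++ (t₁ ++ [v])), ← List.append_assoc a, walkEnd_concat]
          ring
        · intro γ hγ
          rcases Multiset.mem_cons.1 hγ with rfl | hγ
          · exact ⟨by simp, hnd.2, fun y hy => hvt y (List.mem_append_right _ hy)⟩
          · exact hm γ hγ
      · refine ⟨a, t ++ [v], m, ha, by grind, hva, ?_, ?_, ?_, ?_, hm⟩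
        · intro y hy
          rcases List.mem_append.1 hy with hy | hy
          · exact hvt y hy
          · rwa [List.mem_singleton.1 hy]
        · simp [← List.append_assoc]
        · simp at hl ⊢; omega
        · rw [hwv, List.append_assoc]
    -- A new vertex: `a` absorbs `t` and `v`. It grows by at most `card V + 1`, paid for by the
    -- additional visited vertex.
    · refine ⟨a ++ t ++ [v], [], m, ?_, by simp, ?_, by simp, by simp [-List.append_assoc],
        ?_, ?_, ?_⟩
      · rw [hvis, Finset.card_insert_of_notMem hv]
        have := ht.length_le_card
        simp only [List.length_append, List.length_singleton]
        linarith
      · ext y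
        have h1 := hvt y
        have h2 : y ∈ visited x a ↔ y ∈ visited x l := by rw [hva]
        simp only [mem_visited, List.mem_append, List.mem_singleton] at h1 h2 ⊢
        tauto
      · simp at hl ⊢; omega
      · rw [hwv, List.append_nil]
      · exact fun γ hγ => ⟨(hm γ hγ).1, (hm γ hγ).2.1, fun y hy => by
          rw [hvis]; exact Finset.mem_insert_of_mem ((hm γ hγ).2.2 y hy)⟩

theorem exists_decomposition [Fintype V] (A : Matrix V V R) (x : V) (l : List V) :
    ∃ (s : List V) (m : Multiset (List V)),
      s.length ≤ (Fintype.card V + 2) * Fintype.card V ∧ visited x s = visited x l ∧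
      walkEnd x s = walkEnd x l ∧
      l.length = s.length + (m.map List.length).sum ∧
      walkWeight A x l = walkWeight A x s * (m.map (cycleWeight A)).prod ∧
      ∀ γ ∈ m, γ ≠ [] ∧ γ.Nodup ∧ ∀ y ∈ γ, y ∈ visited x l := by
  obtain ⟨a, t, m, ha, ht, hva, hvt, he, hl, hw, hm⟩ := exists_decomposition_aux A x l
  refine ⟨a ++ t, m, ?_, ?_, he, hl, hw, hm⟩
  · have h1 := ht.length_le_card
    have h2 := Nat.mul_le_mul_left (Fintype.card V + 1) (Finset.card_le_univ (visited x l))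
    rw [List.length_append]
    linarith
  · ext y
    have h1 := hvt y
    have h2 : y ∈ visited x a ↔ y ∈ visited x l := by rw [hva]
    simp only [mem_visited, List.mem_append] at h1 h2 ⊢
    tauto

/-- The nonempty lists without repetitions, which represent the simple cycles. -/
noncomputable def simpleCycles (V : Type*) [DecidableEq V] [Fintype V] : Finset (List V) :=
  (Finset.Icc 1 (Fintype.card V)).biUnion fun k =>
    Finset.univ.image fun f : Fin k ↪ V => List.ofFn f

theorem mem_simpleCycles [Fintype V] {γ : List V} :
    γ ∈ simpleCycles V ↔ γ ≠ [] ∧ γ.Nodup := by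
  simp only [simpleCycles, Finset.mem_biUnion, Finset.mem_Icc, Finset.mem_image, Finset.mem_univ,
    true_and]
  constructor
  · rintro ⟨k, hk, f, rfl⟩
    exact ⟨by simp; omega, List.nodup_ofFn.2 f.injective⟩
  · rintro ⟨h0, h⟩
    exact ⟨γ.length, ⟨List.length_pos_iff.2 h0, h.length_le_card⟩,
      ⟨γ.get, List.nodup_iff_injective_get.1 h⟩, List.ofFn_get γ⟩

/-- The sum `S n` satisfies `S (n + 1) = (n + 1) * S n + 1`. The strict inequality is what absorbs
the `+ 1` in the induction. -/
theorem sum_descFactorial_lt (n : ℕ) :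
    ∑ k ∈ Finset.range (n + 1), n.descFactorial k < 3 * n.factorial := by
  induction n with
  | zero => simp
  | succ n ih =>
    rw [Finset.sum_range_succ']
    simp only [Nat.succ_descFactorial_succ, ← Finset.mul_sum, Nat.descFactorial_zero,
      Nat.factorial_succ]
    rcases Nat.eq_zero_or_pos n with rfl | hn
    · simp
    · nlinarith

theorem card_simpleCycles_le [Fintype V] :
    (simpleCycles V).card ≤ 3 * (Fintype.card V).factorial := by
  refine le_trans ?_ (sum_descFactorial_lt (Fintype.card V)).le
  refine Finset.card_biUnion_le.trans ?_
  refine (Finset.sum_le_sum fun k _ => Finset.card_image_le).trans ?_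
  simp only [Finset.card_univ, Fintype.card_embedding_eq, Fintype.card_fin]
  exact Finset.sum_le_sum_of_subset fun k hk => by simp at hk ⊢; omega

/-- A long walk contains a simple cycle so often that copies of total length `(card V)!` can be
removed without changing the set of visited vertices. -/
theorem exists_remove_cycles [Fintype V] (A : Matrix V V R) (x : V) (l : List V) (n : ℕ)
    (hl : l.length = n + (Fintype.card V).factorial)
    (hn : (Fintype.card V + 2) * Fintype.card V + 3 * (Fintype.card V).factorial ^ 2 ≤ n) :
    ∃ γ ∈ simpleCycles V, (∀ y ∈ γ, y ∈ visited x l) ∧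
      ∃ l', l'.length = n ∧ visited x l' = visited x l ∧ walkEnd x l' = walkEnd x l ∧
        walkWeight A x l =
          cycleWeight A γ ^ ((Fintype.card V).factorial / γ.length) * walkWeight A x l' := by
  set F := (Fintype.card V).factorial with hF
  have hFpos : 0 < F := Nat.factorial_pos _
  obtain ⟨s, m, hs, hvs, hes, hls, hws, hm⟩ := exists_decomposition A x l
  -- Pigeonhole: otherwise each of the at most `3 * F` distinct cycles has total length at most `F`,
  -- and the walk is too short.
  have hex : ∃ γ ∈ m, F / γ.length ≤ m.count γ := by
    by_contra! hcon
    have h1 : (m.map List.length).sum ≤ 3 * F * F := by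
      rw [Finset.sum_multiset_map_count]
      calc ∑ γ ∈ m.toFinset, m.count γ • γ.length ≤ ∑ γ ∈ m.toFinset, F := by
            refine Finset.sum_le_sum fun γ hγ => ?_
            rw [smul_eq_mul]
            exact (Nat.mul_le_mul_right _ (hcon γ (Multiset.mem_toFinset.1 hγ)).le).trans
              (Nat.div_mul_le_self _ _)
        _ = m.toFinset.card * F := by simp
        _ ≤ 3 * F * F := by
            refine Nat.mul_le_mul_right _ (le_trans (Finset.card_le_card fun γ hγ => ?_)
              card_simpleCycles_le)
            have := hm γ (Multiset.mem_toFinset.1 hγ)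
            exact mem_simpleCycles.2 ⟨this.1, this.2.1⟩
    nlinarith
  obtain ⟨γ, hγ, hc⟩ := hex
  obtain ⟨h0, hnd, hsub⟩ := hm γ hγ
  obtain ⟨m', rfl⟩ := Multiset.le_iff_exists_add.1 (Multiset.le_count_iff_replicate_le.1 hc)
  -- The shorter walk is rebuilt by putting all remaining cycles back into `s`.
  obtain ⟨l', hv', he', hl', hw'⟩ := exists_insert_cycles A x s m' fun δ hδ => by
    rw [hvs]; exact (hm δ (Multiset.mem_add.2 (Or.inr hδ))).2.2
  have hdvd : F / γ.length * γ.length = F :=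
    Nat.div_mul_cancel (Nat.dvd_factorial (List.length_pos_iff.2 h0) hnd.length_le_card)
  refine ⟨γ, mem_simpleCycles.2 ⟨h0, hnd⟩, hsub, l', ?_, hv'.trans hvs, he'.trans hes, ?_⟩
  · simp only [Multiset.map_add, Multiset.map_replicate, Multiset.sum_add, Multiset.sum_replicate,
      smul_eq_mul, hdvd] at hls
    omega
  · rw [hws, hw', Multiset.map_add, Multiset.map_replicate, Multiset.prod_add,
      Multiset.prod_replicate]
    ring

theorem exists_insert_cycle_pow [Fintype V] (A : Matrix V V R) (x : V) (l γ : List V)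
    (hγ : γ ∈ simpleCycles V) (hsub : ∀ y ∈ γ, y ∈ visited x l) :
    ∃ l', l'.length = l.length + (Fintype.card V).factorial ∧ visited x l' = visited x l ∧
      walkEnd x l' = walkEnd x l ∧
      walkWeight A x l' =
        cycleWeight A γ ^ ((Fintype.card V).factorial / γ.length) * walkWeight A x l := by
  obtain ⟨h0, hnd⟩ := mem_simpleCycles.1 hγ
  obtain ⟨l', hv', he', hl', hw'⟩ := exists_insert_cycles A x l
    (Multiset.replicate ((Fintype.card V).factorial / γ.length) γ) fun δ hδ => by
      rw [Multiset.eq_of_mem_replicate hδ]; exact hsub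
  refine ⟨l', ?_, hv', he', ?_⟩
  · rw [hl', Multiset.map_replicate, Multiset.sum_replicate, smul_eq_mul,
      Nat.div_mul_cancel (Nat.dvd_factorial (List.length_pos_iff.2 h0) hnd.length_le_card)]
  · rw [hw', Multiset.map_replicate, Multiset.prod_replicate, mul_comm]

end Walks

/-! ### Sums in idempotent semirings -/

section Idempotent

variable {R : Type*} [CommSemiring R]

theorem sum_add_eq_of_forall_add_eq {ι : Type*} (s : Finset ι) (f : ι → R) (a : R)
    (h : ∀ i ∈ s, f i + a = a) : ∑ i ∈ s, f i + a = a := by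
  classical
  induction s using Finset.induction_on with
  | empty => simp
  | insert i s hi ih =>
    rw [Finset.sum_insert hi, add_assoc, ih fun j hj => h j (Finset.mem_insert_of_mem hj),
      h i (Finset.mem_insert_self i s)]

theorem add_sum_eq_of_mem (hR : ∀ a : R, a + a = a) {ι : Type*} {s : Finset ι} (f : ι → R)
    {i : ι} (hi : i ∈ s) : f i + ∑ j ∈ s, f j = ∑ j ∈ s, f j := by
  classical
  rw [← Finset.add_sum_erase s f hi, ← add_assoc, hR]

/-- In an idempotent semiring, a finite sum depends only on the set of its terms. -/
theorem sum_eq_sum_of_forall_exists (hR : ∀ a : R, a + a = a) {ι κ : Type*} {s : Finset ι}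
    {t : Finset κ} {f : ι → R} {g : κ → R} (hst : ∀ i ∈ s, ∃ j ∈ t, f i = g j)
    (hts : ∀ j ∈ t, ∃ i ∈ s, g j = f i) : ∑ i ∈ s, f i = ∑ j ∈ t, g j := by
  have h1 : ∑ i ∈ s, f i + ∑ j ∈ t, g j = ∑ j ∈ t, g j :=
    sum_add_eq_of_forall_add_eq s f _ fun i hi => by
      obtain ⟨j, hj, h⟩ := hst i hi
      rw [h, add_sum_eq_of_mem hR g hj]
  have h2 : ∑ j ∈ t, g j + ∑ i ∈ s, f i = ∑ i ∈ s, f i :=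
    sum_add_eq_of_forall_add_eq t g _ fun j hj => by
      obtain ⟨i, hi, h⟩ := hts j hj
      rw [h, add_sum_eq_of_mem hR f hi]
  rw [← h1, add_comm, h2]

end Idempotent

/-! ### Walk sums by visited set and their recurrence -/

section WalkSums

variable {V R : Type*} [CommSemiring R]

/-- The weight of a walk from entry to exit. -/
def walkTerm (c : V → R) (A : Matrix V V R) (b : V → R) (x : V) (l : List V) : R :=
  c x * (walkWeight A x l * b (walkEnd x l))

variable [DecidableEq V] [Fintype V]

theorem pow_mulVec_eq_sum_walkWeight (A : Matrix V V R) (b : V → R) (n : ℕ) (x : V) :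
    ((A ^ n).mulVec b) x =
      ∑ f : Fin n → V, walkWeight A x (List.ofFn f) * b (walkEnd x (List.ofFn f)) := by
  induction n generalizing x with
  | zero => simp [walkWeight, walkEnd]
  | succ n ih =>
    rw [pow_succ', ← Matrix.mulVec_mulVec, ← (Fin.consEquiv fun _ => V).sum_comp,
      Fintype.sum_prod_type]
    simp only [Matrix.mulVec, dotProduct] at ih ⊢
    refine Finset.sum_congr rfl fun y _ => ?_
    rw [ih, Finset.mul_sum]
    refine Finset.sum_congr rfl fun f _ => ?_
    simp [Fin.consEquiv, List.ofFn_succ, walkWeight, walkEnd, mul_assoc]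

/-- The sum of the weights of the walks of length `n` whose set of visited vertices is `Z`. -/
noncomputable def walkSum (c : V → R) (A : Matrix V V R) (b : V → R) (Z : Finset V) (n : ℕ) : R :=
  ∑ p : V × (Fin n → V) with visited p.1 (List.ofFn p.2) = Z,
    walkTerm c A b p.1 (List.ofFn p.2)

theorem dotProduct_pow_mulVec_eq_sum_walkSum (c : V → R) (A : Matrix V V R) (b : V → R) (n : ℕ) :
    c ⬝ᵥ (A ^ n).mulVec b = ∑ Z, walkSum c A b Z n := by
  simp only [walkSum, Finset.sum_fiberwise, Fintype.sum_prod_type, dotProduct,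
    pow_mulVec_eq_sum_walkWeight, Finset.mul_sum, walkTerm]

/-- The sum over the simple cycles in `Z` of the powers of their weights of total length
`(card V)!`. -/
noncomputable def loopSum (A : Matrix V V R) (Z : Finset V) : R :=
  ∑ γ ∈ simpleCycles V with ∀ y ∈ γ, y ∈ Z,
    cycleWeight A γ ^ ((Fintype.card V).factorial / γ.length)

/-- Fixing `Z` makes the insertable cycles the same for all walks in the sum, which is why one
factor serves them all. The correspondence between long walks and pairs (cycle, short walk) is not
bijective; idempotency makes this harmless. -/
theorem walkSum_add_factorial (hR : ∀ a : R, a + a = a) (c : V → R) (A : Matrix V V R) (b : V → R)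
    (Z : Finset V) (n : ℕ)
    (hn : (Fintype.card V + 2) * Fintype.card V + 3 * (Fintype.card V).factorial ^ 2 ≤ n) :
    walkSum c A b Z (n + (Fintype.card V).factorial) = loopSum A Z * walkSum c A b Z n := by
  rw [walkSum, walkSum, loopSum, Finset.sum_mul_sum, ← Finset.sum_product']
  refine sum_eq_sum_of_forall_exists hR ?_ ?_
  · rintro ⟨x, f⟩ hf
    rw [Finset.mem_filter] at hf
    obtain ⟨γ, hγ, hsub, l', rfl, hv, he, hw⟩ :=
      exists_remove_cycles A x (List.ofFn f) n (by simp) hn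
    refine ⟨(γ, (x, l'.get)), ?_, ?_⟩
    · rw [hf.2] at hsub
      simp only [Finset.mem_product, Finset.mem_filter, Finset.mem_univ, true_and,
        List.ofFn_get]
      exact ⟨⟨hγ, hsub⟩, hv.trans hf.2⟩
    · simp only [List.ofFn_get, walkTerm, hw, he]
      ring
  · rintro ⟨γ, x, f⟩ hf
    simp only [Finset.mem_product, Finset.mem_filter, Finset.mem_univ, true_and] at hf
    obtain ⟨l', hl, hv, he, hw⟩ := exists_insert_cycle_pow A x (List.ofFn f) γ hf.1.1
      (by rw [hf.2]; exact hf.1.2)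
    rw [List.length_ofFn] at hl
    obtain ⟨g, rfl⟩ : ∃ g : Fin (n + (Fintype.card V).factorial) → V, List.ofFn g = l' := by
      rw [← hl]; exact ⟨l'.get, List.ofFn_get l'⟩
    refine ⟨(x, g), ?_, ?_⟩
    · simpa using hv.trans hf.2
    · simp only [walkTerm, hw, he]
      ring

end WalkSums

/-! ### From eventually geometric sequences to expressions -/

section Expressions

variable {R : Type*} [CommSemiring R]

open PowerSeries

theorem coeff_C_mul_X_pow_mul_kleeneStar {c μ : ℕ} (hμ : μ < c) (u q : R) (n : ℕ) :
    coeff n (C u * X ^ μ * kleeneStar (C q * X ^ c)) =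
      if n % c = μ then u * q ^ (n / c) else 0 := by
  have hc : 0 < c := by omega
  have hstar : ∀ m, coeff m (kleeneStar (C q * X ^ c)) = if c ∣ m then q ^ (m / c) else 0 := by
    intro m
    simp only [kleeneStar, coeff_mk, mul_pow, ← map_pow, ← pow_mul, coeff_C_mul, coeff_X_pow,
      mul_ite, mul_one, mul_zero]
    split_ifs with h
    · obtain ⟨k, rfl⟩ := h
      rw [Nat.mul_div_cancel_left k hc, Finset.sum_eq_single k]
      · simp
      · intro j _ hj
        rw [if_neg fun h => hj (Nat.eq_of_mul_eq_mul_left hc h).symm]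
      · intro hk
        exact absurd (Finset.mem_range.2 (Nat.lt_succ_of_le (Nat.le_mul_of_pos_left k hc))) hk
    · exact Finset.sum_eq_zero fun j _ => if_neg fun hj => h ⟨j, hj⟩
  rw [mul_assoc, coeff_C_mul, coeff_X_pow_mul', hstar]
  by_cases h : n % c = μ
  · have hle : μ ≤ n := h ▸ Nat.mod_le n c
    have hsub : n - μ = c * (n / c) := by
      have := Nat.mod_add_div n c
      omega
    rw [if_pos hle, if_pos h, hsub, if_pos (dvd_mul_right _ _), Nat.mul_div_cancel_left _ hc]
  · rw [if_neg h]
    split_ifs with h1 h2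
    · obtain ⟨k, hk⟩ := h2
      refine absurd ?_ h
      rw [show n = μ + c * k by omega, Nat.add_mul_mod_self_left, Nat.mod_eq_of_lt hμ]
    · simp
    · simp

/-- A sum of finitely many sequences that are eventually geometric along residue classes has a
star-height-one expression. -/
theorem exists_starHeightOneExpr {ι : Type*} [Fintype ι] (S : PowerSeries R) (T : ι → ℕ → R)
    (q : ι → R) (c κ : ℕ) (hc : 0 < c) (hS : ∀ n, coeff n S = ∑ i, T i n)
    (hT : ∀ i n, κ * c ≤ n → T i (n + c) = q i * T i n) :
    ∃ E : StarHeightOneExpr R, S = E.series ∧ E.c = c ∧ E.κ = κ ∧ E.ρ = Fintype.card ι * c ∧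
      (∀ i < κ * c, E.P.coeff i = coeff i S) ∧
      ∀ k, ∃ i, ∃ r < c, E.u k = T i (κ * c + r) ∧ E.q k = q i := by
  classical
  have hgeom : ∀ i r k, T i (κ * c + (r + c * k)) = T i (κ * c + r) * q i ^ k := by
    intro i r k
    induction k with
    | zero => simp
    | succ k ih =>
      rw [show κ * c + (r + c * (k + 1)) = κ * c + (r + c * k) + c by ring, hT _ _ (by omega), ih]
      ring
  -- One term for each sequence `i` and residue `r`, with leading coefficient the value of `T i` at
  -- `κ * c + r`.
  let e : Fin (Fintype.card ι * c) ≃ ι × Fin c :=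
    (Fintype.equivFinOfCardEq (by simp)).symm
  refine ⟨⟨c, hc, κ, Fintype.card ι * c, trunc (κ * c) S, degree_trunc_lt _ _,
    fun k => T (e k).1 (κ * c + (e k).2), fun k => q (e k).1, fun k => (e k).2,
    fun k => (e k).2.2⟩, ?_, rfl, rfl, rfl, ?_, fun k => ⟨_, _, (e k).2.2, rfl, rfl⟩⟩
  · ext n
    simp only [StarHeightOneExpr.series, map_add, Polynomial.coeff_coe, coeff_trunc,
      coeff_X_pow_mul']
    by_cases hn : n < κ * c
    · rw [if_pos hn, if_neg (by omega), add_zero]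
    · obtain ⟨m, rfl⟩ := Nat.exists_eq_add_of_le (not_lt.1 hn)
      rw [if_neg hn, if_pos (by omega), zero_add, Nat.add_sub_cancel_left, map_sum]
      rw [e.sum_comp fun p : ι × Fin c => coeff m (C (T p.1 (κ * c + p.2)) * X ^ (p.2 : ℕ) *
        kleeneStar (C (q p.1) * X ^ c)), Fintype.sum_prod_type, hS]
      refine Finset.sum_congr rfl fun i _ => ?_
      have hm : m % c < c := Nat.mod_lt _ hc
      simp only [coeff_C_mul_X_pow_mul_kleeneStar (Fin.is_lt _)]
      rw [Finset.sum_eq_single ⟨m % c, hm⟩]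
      · rw [if_pos rfl, ← hgeom, Nat.mod_add_div]
      · intro r _ hr
        exact if_neg fun h => hr (Fin.ext h.symm)
      · simp
  · intro i hi
    simp [coeff_trunc, hi]

end Expressions

/-! ### Degrees and numbers of monomials -/

section MonomialCount

variable {σ K : Type*} [CommSemiring K]

theorem mvPolynomial_add_self (hK : ∀ a : K, a + a = a) (p : MvPolynomial σ K) : p + p = p := by
  ext d
  rw [MvPolynomial.coeff_add, hK]

theorem totalDegree_X_le (s : σ) : (MvPolynomial.X s : MvPolynomial σ K).totalDegree ≤ 1 :=
  (MvPolynomial.totalDegree_monomial_le _ _).trans (by simp)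

/-- All exponent vectors lie in the box `{0, …, d} ^ σ`. -/
theorem card_support_le_of_totalDegree_le [Fintype σ] (p : MvPolynomial σ K) (d : ℕ)
    (hp : p.totalDegree ≤ d) : p.support.card ≤ (d + 1) ^ Fintype.card σ := by
  classical
  have hcard : (Fintype.piFinset fun _ : σ => Finset.range (d + 1)).card =
      (d + 1) ^ Fintype.card σ := by simp
  rw [← hcard]
  refine Finset.card_le_card_of_injOn (fun m => ⇑m) (fun m hm => ?_)
    (DFunLike.coe_injective.injOn)
  simp only [Fintype.coe_piFinset, Set.mem_pi, Finset.mem_coe, Finset.mem_range]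
  intro s _
  have h1 := MvPolynomial.monomial_le_degreeOf s hm
  have h2 := MvPolynomial.degreeOf_le_totalDegree p s
  omega

variable {V : Type*}

theorem totalDegree_walkWeight_le (A : Matrix V V (MvPolynomial σ K))
    (hA : ∀ i j, (A i j).totalDegree ≤ 1) (x : V) (l : List V) :
    (walkWeight A x l).totalDegree ≤ l.length := by
  induction l generalizing x with
  | nil => simp [walkWeight]
  | cons y l ih =>
    refine (MvPolynomial.totalDegree_mul _ _).trans ?_
    have := hA x y
    have := ih y
    simp only [List.length_cons]
    omega

theorem totalDegree_cycleWeight_le (A : Matrix V V (MvPolynomial σ K))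
    (hA : ∀ i j, (A i j).totalDegree ≤ 1) (l : List V) :
    (cycleWeight A l).totalDegree ≤ l.length := by
  cases l with
  | nil => simp [cycleWeight]
  | cons v g => simpa [cycleWeight] using totalDegree_walkWeight_le A hA v (g ++ [v])

variable [DecidableEq V] [Fintype V]

theorem totalDegree_walkSum_le (c : V → MvPolynomial σ K) (A : Matrix V V (MvPolynomial σ K))
    (b : V → MvPolynomial σ K) (hc : ∀ i, (c i).totalDegree ≤ 1)
    (hA : ∀ i j, (A i j).totalDegree ≤ 1) (hb : ∀ i, (b i).totalDegree ≤ 1)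
    (Z : Finset V) (n : ℕ) : (walkSum c A b Z n).totalDegree ≤ n + 2 := by
  refine MvPolynomial.totalDegree_finsetSum_le fun p _ => ?_
  have h1 := MvPolynomial.totalDegree_mul (c p.1)
    (walkWeight A p.1 (List.ofFn p.2) * b (walkEnd p.1 (List.ofFn p.2)))
  have h2 := MvPolynomial.totalDegree_mul (walkWeight A p.1 (List.ofFn p.2))
    (b (walkEnd p.1 (List.ofFn p.2)))
  have h3 := totalDegree_walkWeight_le A hA p.1 (List.ofFn p.2)
  have h4 := hc p.1
  have h5 := hb (walkEnd p.1 (List.ofFn p.2))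
  rw [List.length_ofFn] at h3
  rw [walkTerm]
  omega

theorem totalDegree_loopSum_le (A : Matrix V V (MvPolynomial σ K))
    (hA : ∀ i j, (A i j).totalDegree ≤ 1) (Z : Finset V) :
    (loopSum A Z).totalDegree ≤ (Fintype.card V).factorial := by
  refine MvPolynomial.totalDegree_finsetSum_le fun γ _ => ?_
  exact (MvPolynomial.totalDegree_pow _ _).trans
    ((Nat.mul_le_mul_left _ (totalDegree_cycleWeight_le A hA γ)).trans (Nat.div_mul_le_self _ _))

end MonomialCount

/-! ### Explicit expressions and numerical bounds -/

section Realizations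

/-- The right side is `κ * c` for `κ = 6 * N!` and `c = N!`, so the recurrence holds from the end of
the transient part on. -/
theorem walk_threshold_le (N : ℕ) :
    (N + 2) * N + 3 * N.factorial ^ 2 ≤ 6 * N.factorial * N.factorial := by
  have h1 := Nat.self_le_factorial N
  have h2 := Nat.factorial_pos N
  nlinarith

theorem exists_expr_realizationSeries {R : Type*} [CommSemiring R] (hR : ∀ a : R, a + a = a)
    {N : ℕ} (c : Fin N → R) (A : Matrix (Fin N) (Fin N) R) (b : Fin N → R) :
    ∃ E : StarHeightOneExpr R, realizationSeries c A b = E.series ∧ E.c = N.factorial ∧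
      E.κ = 6 * N.factorial ∧ E.ρ = 2 ^ N * N.factorial ∧
      (∀ i < 6 * N.factorial * N.factorial, E.P.coeff i = ∑ Z, walkSum c A b Z i) ∧
      ∀ k, ∃ Z, ∃ r < N.factorial,
        E.u k = walkSum c A b Z (6 * N.factorial * N.factorial + r) ∧ E.q k = loopSum A Z := by
  have hS : ∀ n, PowerSeries.coeff n (realizationSeries c A b) = ∑ Z, walkSum c A b Z n := by
    intro n
    rw [coeff_realizationSeries, dotProduct_pow_mulVec_eq_sum_walkSum]
  obtain ⟨E, h1, h2, h3, h4, h5, h6⟩ := exists_starHeightOneExpr (realizationSeries c A b)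
    (walkSum c A b) (loopSum A) N.factorial (6 * N.factorial) (Nat.factorial_pos N) hS
    (fun Z n hn => by
      have := walkSum_add_factorial hR c A b Z n
      rw [Fintype.card_fin] at this
      exact this ((walk_threshold_le N).trans hn))
  refine ⟨E, h1, h2, h3, by simpa using h4, fun i hi => (h5 i hi).trans (hS i), h6⟩

/-- The indeterminates of the universal series as a disjoint union. -/
def realizationVarEquiv (N : ℕ) : RealizationVar N ≃ Fin N ⊕ (Fin N × Fin N) ⊕ Fin N where
  toFun
    | .c i => .inl i
    | .A i j => .inr (.inl (i, j))
    | .b j => .inr (.inr j)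
  invFun
    | .inl i => .c i
    | .inr (.inl p) => .A p.1 p.2
    | .inr (.inr j) => .b j
  left_inv v := by cases v <;> rfl
  right_inv v := by rcases v with i | p | j <;> rfl

instance (N : ℕ) : Fintype (RealizationVar N) := Fintype.ofEquiv _ (realizationVarEquiv N).symm

theorem card_realizationVar (N : ℕ) : Fintype.card (RealizationVar N) = 2 * N + N ^ 2 := by
  rw [Fintype.card_congr (realizationVarEquiv N)]
  simp
  ring

theorem quartic_le_factorial (N : ℕ) :
    (4 + 2 * N ^ 2) * (2 * N + N ^ 2) ≤ 100 * N.factorial := by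
  rcases Nat.lt_or_ge N 3 with h | h
  · interval_cases N <;> simp [Nat.factorial]
  -- The step needs the quartic to grow by a factor of at most `n + 1`, which fails for `n = 1, 2`;
  -- hence the start at `3`.
  · induction N, h using Nat.le_induction with
    | base => simp [Nat.factorial]
    | succ n hn ih =>
      rw [Nat.factorial_succ]
      have key : (4 + 2 * (n + 1) ^ 2) * (2 * (n + 1) + (n + 1) ^ 2) ≤
          (n + 1) * ((4 + 2 * n ^ 2) * (2 * n + n ^ 2)) := by
        obtain ⟨k, rfl⟩ := Nat.exists_eq_add_of_le hn
        nlinarith [Nat.zero_le k, Nat.zero_le (k ^ 2), Nat.zero_le (k ^ 3), Nat.zero_le (k ^ 4),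
          Nat.zero_le (k ^ 5)]
      nlinarith

theorem two_pow_mul_factorial_le (N : ℕ) :
    2 ^ N * N.factorial ≤ 2 ^ (100 * N.factorial) := by
  calc 2 ^ N * N.factorial ≤ 2 ^ N.factorial * 2 ^ N.factorial :=
        Nat.mul_le_mul (Nat.pow_le_pow_right two_pos (Nat.self_le_factorial N))
          Nat.lt_two_pow_self.le
    _ = 2 ^ (N.factorial + N.factorial) := (pow_add _ _ _).symm
    _ ≤ 2 ^ (100 * N.factorial) := Nat.pow_le_pow_right two_pos (by omega)

/-- Since `N! ≤ 2 ^ (N ^ 2)`, the left side is at most 2 to a quartic polynomial in `N`, far below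
`N!` asymptotically. -/
theorem monomial_bound_le (N : ℕ) :
    (6 * N.factorial * N.factorial + N.factorial + 2 + 1) ^ (2 * N + N ^ 2) ≤
      2 ^ (100 * N.factorial) := by
  have h1 := Nat.factorial_pos N
  have h2 : N.factorial ≤ 2 ^ (N ^ 2) :=
    calc N.factorial ≤ N ^ N := Nat.factorial_le_pow N
      _ ≤ (2 ^ N) ^ N := Nat.pow_le_pow_left Nat.lt_two_pow_self.le N
      _ = 2 ^ (N ^ 2) := by rw [← pow_mul, sq]
  have h3 : 6 * N.factorial * N.factorial + N.factorial + 2 + 1 ≤ 2 ^ (4 + 2 * N ^ 2) :=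
    calc 6 * N.factorial * N.factorial + N.factorial + 2 + 1
        ≤ 16 * (N.factorial * N.factorial) := by nlinarith
      _ ≤ 16 * (2 ^ (N ^ 2) * 2 ^ (N ^ 2)) := by gcongr
      _ = 2 ^ (4 + 2 * N ^ 2) := by rw [pow_add, two_mul, pow_add]; norm_num
  calc _ ≤ (2 ^ (4 + 2 * N ^ 2)) ^ (2 * N + N ^ 2) := Nat.pow_le_pow_left h3 _
    _ = 2 ^ ((4 + 2 * N ^ 2) * (2 * N + N ^ 2)) := (pow_mul _ _ _).symm
    _ ≤ _ := Nat.pow_le_pow_right two_pos (quartic_le_factorial N)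

theorem exists_expr_universalSeries (K : Type*) [CommSemiring K] (hK : ∀ a : K, a + a = a)
    (N : ℕ) :
    ∃ E : StarHeightOneExpr (MvPolynomial (RealizationVar N) K),
      universalSeries K N = E.series ∧ E.c = N.factorial ∧ E.κ = 6 * N.factorial ∧
        E.ρ = 2 ^ N * N.factorial ∧ E.maxMonomials ≤ 2 ^ (100 * N.factorial) := by
  obtain ⟨E, h1, h2, h3, h4, h5, h6⟩ := exists_expr_realizationSeries (mvPolynomial_add_self hK)
    (fun i => MvPolynomial.X (RealizationVar.c i))
    (Matrix.of fun i j => MvPolynomial.X (RealizationVar.A i j))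
    (fun j => MvPolynomial.X (RealizationVar.b j) : Fin N → MvPolynomial (RealizationVar N) K)
  -- Walks that matter have length below `6 * N! * N! + N!`; the entry and exit indeterminates add 2
  -- to the degree.
  have hsupp : ∀ p : MvPolynomial (RealizationVar N) K,
      p.totalDegree ≤ 6 * N.factorial * N.factorial + N.factorial + 2 →
        p.support.card ≤ 2 ^ (100 * N.factorial) := fun p hp =>
    (card_support_le_of_totalDegree_le p _ hp).trans
      (card_realizationVar N ▸ monomial_bound_le N)
  have hwalk := totalDegree_walkSum_le
    (fun i => MvPolynomial.X (RealizationVar.c i))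
    (Matrix.of fun i j => MvPolynomial.X (RealizationVar.A i j))
    (fun j => MvPolynomial.X (RealizationVar.b j) : Fin N → MvPolynomial (RealizationVar N) K)
    (fun _ => totalDegree_X_le _) (fun _ _ => totalDegree_X_le _) (fun _ => totalDegree_X_le _)
  refine ⟨E, h1, h2, h3, h4, max_le (Finset.sup_le fun i hi => ?_) (Finset.sup_le fun k _ => ?_)⟩
  · rw [Finset.mem_range, h2, h3] at hi
    rw [h5 i hi]
    refine hsupp _ (MvPolynomial.totalDegree_finsetSum_le fun Z _ => (hwalk Z i).trans ?_)
    omega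
  · obtain ⟨Z, r, hr, hu, hq⟩ := h6 k
    refine max_le (hsupp _ ?_) (hsupp _ ?_)
    · rw [hu]
      exact (hwalk Z _).trans (by omega)
    · rw [hq]
      refine (totalDegree_loopSum_le _ (fun _ _ => totalDegree_X_le _) Z).trans ?_
      rw [Fintype.card_fin]
      omega

end Realizations

end MaxPlus

theorem mainTheorem8 :
    ∃ B : ℕ, ∀ (K : Type*) [CommSemiring K], (∀ a : K, a + a = a) → ∀ N : ℕ,
      (∃ E : MaxPlus.StarHeightOneExpr (MvPolynomial (MaxPlus.RealizationVar N) K),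
        MaxPlus.universalSeries K N = E.series ∧
        E.c = N.factorial ∧
        E.κ ≤ B * N.factorial ∧
        E.ρ ≤ 2 ^ (B * N.factorial) ∧
        E.maxMonomials ≤ 2 ^ (B * N.factorial)) ∧
      (∀ (σ : Type*) (c : Fin N → MvPolynomial σ K)
        (A : Matrix (Fin N) (Fin N) (MvPolynomial σ K)) (b : Fin N → MvPolynomial σ K),
        ∃ E : MaxPlus.StarHeightOneExpr (MvPolynomial σ K),
          MaxPlus.realizationSeries c A b = E.series ∧
          E.c = N.factorial ∧
          E.κ ≤ B * N.factorial ∧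
          E.ρ ≤ 2 ^ (B * N.factorial)) := by
  -- The constant 100 comes from `quartic_le_factorial` and is not sharp; `κ` needs only 6.
  refine ⟨100, fun K _ hK N => ⟨?_, fun σ c A b => ?_⟩⟩
  · obtain ⟨E, h1, h2, h3, h4, h5⟩ := MaxPlus.exists_expr_universalSeries K hK N
    exact ⟨E, h1, h2, by omega, h4.trans_le (MaxPlus.two_pow_mul_factorial_le N), h5⟩
  · obtain ⟨E, h1, h2, h3, h4, -⟩ :=
      MaxPlus.exists_expr_realizationSeries (MaxPlus.mvPolynomial_add_self hK) c A b
    exact ⟨E, h1, h2, by omega, h4.trans_le (MaxPlus.two_pow_mul_factorial_le N)⟩
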